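/- Let $(x_i)_{i\ge 1}$ be independent real random variables, each with the mixed discrete-continuous distribution $(1-\lambda)\mu_d+\lambda\mu_c$, where $0\le\lambda\le 1$, $\mu_d$ is a discrete probability distribution on $\mathbb{R}$ and $\mu_c$ is a probability distribution on $\mathbb{R}$ that is absolutely continuous with respect to Lebesgue measure. For $n\in\mathbb{N}$ put $\mathbf{x}=(x_1,\dots,x_n)^{T}$. For $u,v\in\mathbb{R}^n$ write $u\sim v$ if $u=v$ or $u=-v$. An $(n,m)$ code consists of a matrix $A\in\mathbb{R}^{m\times n}$, giving the phaseless measurements $x\mapsto |Ax|\in\mathbb{R}_{\ge 0}^m$ (entrywise absolute value), and a Borel measurable decoder $g:\mathbb{R}_{\ge 0}^m\to\mathbb{R}^n$; its error probability is $\mathbb{P}[g(|A\mathbf{x}|)\not\sim\mathbf{x}]$. A number $R$ with $0<R\le 1$ is called $\varepsilon$-achievable if there are an $N\in\mathbb{N}$ and a sequence of $(n,\lfloor Rn\rfloor)$ codes whose error probability is at most $\varepsilon$ for all $n\ge N$. Let $0<\varepsilon<1$ and $0<R\le 1$. (i) If $R>\lambda$, then $R$ is $\varepsilon$-achievable, and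 this holds for Lebesgue almost all measurement matrices: there is an $N\in\mathbb{N}$ such that for every $n\ge N$ and Lebesgue almost every $A\in\mathbb{R}^{\lfloor Rn\rfloor\times n}$ there is a Borel measurable decoder $g$ with $\mathbb{P}[g(|A\mathbf{x}|)\not\sim\mathbf{x}]\le\varepsilon$. (ii) Conversely, if $R$ is $\varepsilon$-achievable, then $R\ge\lambda$. -/

import Mathlib

open MeasureTheory ProbabilityTheory
open scoped NNReal ENNReal

namespace PhaselessCompression

/-- The relation identifying vectors that agree up to a global sign: `u = v` or `u = -v`. -/
def SignEquiv {n : ℕ} (u v : Fin n → ℝ) : Prop :=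
  u = v ∨ u = -v

/-- The phaseless measurement map `x ↦ |A x|` (componentwise absolute value),
with values in the vectors with nonnegative entries. -/
def phaseless {m n : ℕ} (A : Matrix (Fin m) (Fin n) ℝ) (x : Fin n → ℝ) : Fin m → ℝ≥0 :=
  fun i => Real.nnabs (A.mulVec x i)

/-- An `(n, m)` code: phaseless measurements given by an `m × n` matrix,
together with a Borel measurable decoder. -/
structure Code (n m : ℕ) where
  /-- the measurement matrix -/
  mat : Matrix (Fin m) (Fin n) ℝ
  /-- the decoder -/
  decoder : (Fin m → ℝ≥0) → (Fin n → ℝ)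
  measurable_decoder : Measurable decoder

variable {Ω : Type*} [MeasurableSpace Ω]

/-- The source vector of length `n`: the first `n` components of the process. -/
def sourceVector (X : ℕ → Ω → ℝ) (n : ℕ) (ω : Ω) : Fin n → ℝ :=
  fun i => X i ω

/-- The probability that the decoder does not recover the source vector up to a global sign. -/
noncomputable def errorProb (P : Measure Ω) (X : ℕ → Ω → ℝ) {n m : ℕ} (c : Code n m) : ℝ :=
  P.real {ω | ¬ SignEquiv (c.decoder (phaseless c.mat (sourceVector X n ω))) (sourceVector X n ω)}

/-- `R` is an `ε`-achievable rate: `0 < R ≤ 1`, and some sequence of `(n, ⌊R n⌋)` codes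
has error probability at most `ε` for all sufficiently large `n`. -/
def IsAchievable (P : Measure Ω) (X : ℕ → Ω → ℝ) (ε R : ℝ) : Prop :=
  0 < R ∧ R ≤ 1 ∧
    ∃ (N : ℕ) (c : (n : ℕ) → Code n ⌊R * n⌋₊), ∀ n, N ≤ n → errorProb P X (c n) ≤ ε

/-- `R` is an `ε`-achievable rate for Lebesgue almost all measurement matrices: `0 < R ≤ 1`,
and there is an `N`, not depending on the matrices, such that for all `n ≥ N` and Lebesgue
almost every `⌊R n⌋ × n` matrix `A` there is a code with measurement matrix `A` and error
probability at most `ε`. The Lebesgue measure is the product measure on the entries. -/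
def IsAchievableForAlmostAll (P : Measure Ω) (X : ℕ → Ω → ℝ) (ε R : ℝ) : Prop :=
  0 < R ∧ R ≤ 1 ∧
    ∃ N : ℕ, ∀ n, N ≤ n → ∀ᵐ A : Fin ⌊R * n⌋₊ → Fin n → ℝ ∂volume,
      ∃ c : Code n ⌊R * n⌋₊, c.mat = Matrix.of A ∧ errorProb P X c ≤ ε

/-- The process `X` has independent components, each with the mixed discrete-continuous
distribution `(1 - lam) μd + lam μc`, where `μd` is a discrete and `μc` an absolutely
continuous probability distribution on the real line. -/
structure IsMixedSource (P : Measure Ω) (X : ℕ → Ω → ℝ) (lam : ℝ) (μd μc : Measure ℝ) :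
    Prop where
  lam_nonneg : 0 ≤ lam
  lam_le_one : lam ≤ 1
  prob_discrete : IsProbabilityMeasure μd
  prob_continuous : IsProbabilityMeasure μc
  discrete : ∃ S : Set ℝ, S.Countable ∧ μd Sᶜ = 0
  absolutelyContinuous : μc ≪ volume
  measurable : ∀ i, Measurable (X i)
  indep : iIndepFun X P
  law : ∀ i, P.map (X i) = ENNReal.ofReal (1 - lam) • μd + ENNReal.ofReal lam • μc

end PhaselessCompression

/-! Let S be a countable carrier of `μd`, enlarged to contain 0 and be closed under negation. Since
`μc` does not charge S, by the law of large numbers about λn coordinates of the source lie outside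
S. Achievability: vectors with fewer than m coordinates outside S fill countably many affine
coordinate subspaces of dimension below m. For fixed x, a dimension count
(`volume_rows_orthogonal_eq_zero`) shows that almost no A confuses x with some y ≠ ±x in such a
subspace. By Fubini almost every A is good for almost every x, and the Lusin–Souslin theorem yields
a Borel decoder. Converse: if more than m coordinates lie outside S, A kills a nonzero direction
supported on them. Along a line in this direction the decoder output is constant, hence correct at
two points at most, so by Fubini such vectors are almost never recovered (`pi_recovered_eq_zero`).
If R < λ, the error probability therefore tends to one. -/

namespace PhaselessCompression

/-! ### Collisions for a fixed vector: dimension count -/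

/-- Matrices whose rows annihilate the vectors `x - σ i • y`, for some `y` ranging over an affine
coordinate subspace of dimension less than the number of rows, form a Lebesgue null set. -/
lemma volume_rows_orthogonal_eq_zero {m n : ℕ} (T : Finset (Fin n)) (hT : T.card < m)
    (s x : Fin n → ℝ) (σ : Fin m → ℝ) (j : Fin m → Fin n) :
    volume {A : Fin m → Fin n → ℝ | ∃ y : Fin n → ℝ, (∀ l ∉ T, y l = s l) ∧
      ∀ i, x (j i) - σ i * y (j i) ≠ 0 ∧ ∑ k, A i k * (x k - σ i * y k) = 0} = 0 := by
  classical
  obtain ⟨e⟩ : Nonempty (T ↪ Fin m) :=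
    Function.Embedding.nonempty_of_card_le (by simpa using hT.le)
  obtain ⟨i₀, hi₀⟩ : ∃ i₀, ∀ l, e l ≠ i₀ := by
    by_contra! h
    have := Fintype.card_le_of_surjective e h
    simp at this
    omega
  -- Each row equation determines its pivot entry `(i, j i)`, which frees m slots. The free
  -- coordinates of `y` are stored in the slots of the rows `e l`, and `F` then solves for the true
  -- pivots. The slot of row `i₀` stays unused, so `F` is constant in that direction, its derivative
  -- is singular, and its image is null by Sard's argument.
  let Y : (Fin m → Fin n → ℝ) → Fin n → ℝ :=
    fun A l => if h : l ∈ T then A (e ⟨l, h⟩) (j (e ⟨l, h⟩)) else s l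
  let F : (Fin m → Fin n → ℝ) → Fin m → Fin n → ℝ := fun A i k =>
    if k = j i then -(∑ k' ∈ Finset.univ.erase (j i), A i k' * (x k' - σ i * Y A k')) /
      (x (j i) - σ i * Y A (j i)) else A i k
  let s₀ : Set (Fin m → Fin n → ℝ) := {A | ∀ i, x (j i) - σ i * Y A (j i) ≠ 0}
  have hY : ∀ l, Differentiable ℝ fun A => Y A l := by
    intro l
    by_cases h : l ∈ T
    · simp only [Y, h, dif_pos]; fun_prop
    · simp only [Y, h, dif_neg, not_false_eq_true]; fun_prop
  have hF : ∀ A ∈ s₀, DifferentiableAt ℝ F A := by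
    intro A hA
    refine differentiableAt_pi.2 fun i => differentiableAt_pi.2 fun k => ?_
    by_cases h : k = j i
    · simp only [F, h, if_true]
      have hY' := fun l => (hY l).differentiableAt (x := A)
      have := hA i
      simp only [div_eq_mul_inv]
      exact DifferentiableAt.fun_mul (by fun_prop) (DifferentiableAt.fun_inv (by fun_prop) this)
    · simp only [F, h, if_false]; fun_prop
  let v : Fin m → Fin n → ℝ := Pi.single i₀ (Pi.single (j i₀) 1)
  have hvT : ∀ (A : Fin m → Fin n → ℝ) (t : ℝ), Y (A + t • v) = Y A := by
    intro A t
    funext l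
    by_cases h : l ∈ T
    · simp [Y, h, v, Pi.single_eq_of_ne (hi₀ ⟨l, h⟩)]
    · simp [Y, h]
  have hv0 : ∀ i k, k ≠ j i → v i k = 0 := by
    intro i k hk
    by_cases hi : i = i₀
    · subst hi; simp [v, hk]
    · simp [v, hi]
  have hvF : ∀ (A : Fin m → Fin n → ℝ) (t : ℝ), F (A + t • v) = F A := by
    intro A t
    funext i k
    simp only [F, hvT]
    by_cases h : k = j i
    · simp only [h, if_true]
      congr 2
      refine Finset.sum_congr rfl fun k' hk' => ?_
      simp [hv0 i k' (Finset.ne_of_mem_erase hk')]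
    · simp [h, hv0 i k h]
  have hdet : ∀ A ∈ s₀, (fderiv ℝ F A).det = 0 := by
    intro A hA
    have h1 := (hF A hA).hasFDerivAt.hasLineDerivAt v
    have h2 : fderiv ℝ F A v = 0 := by
      have h3 : HasDerivAt (fun t : ℝ => F (A + t • v)) (fderiv ℝ F A v) 0 := h1
      simp only [hvF] at h3
      exact h3.unique (hasDerivAt_const _ _)
    refine LinearMap.det_eq_zero_iff_ker_ne_bot.2 fun hb => ?_
    have : v = 0 := (LinearMap.ker_eq_bot'.1 hb) v h2
    have := congrFun (congrFun this i₀) (j i₀)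
    simp [v] at this
  refine measure_mono_null ?_ (addHaar_image_eq_zero_of_det_fderivWithin_eq_zero volume
    (fun A hA => (hF A hA).hasFDerivAt.hasFDerivWithinAt) hdet)
  rintro A ⟨y, hy, hA⟩
  let B : Fin m → Fin n → ℝ := fun i k =>
    if h : k = j i ∧ ∃ l, e l = i then y (h.2.choose : T) else A i k
  have hYB : Y B = y := by
    funext l
    by_cases h : l ∈ T
    · have hex : ∃ l', e l' = e ⟨l, h⟩ := ⟨_, rfl⟩
      have := e.injective hex.choose_spec
      simp only [Y, B, h, dif_pos]
      rw [dif_pos ⟨trivial, hex⟩, this]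
    · simp [Y, h, hy l h]
  refine ⟨B, fun i => ?_, ?_⟩
  · rw [hYB]; exact (hA i).1
  · funext i k
    simp only [F, hYB]
    have hB : ∀ k, k ≠ j i → B i k = A i k := fun k hk => by simp [B, hk]
    by_cases h : k = j i
    · subst h
      obtain ⟨h1, h2⟩ := hA i
      rw [if_pos rfl, div_eq_iff h1, ← Finset.add_sum_erase _ _ (Finset.mem_univ (j i))] at *
      rw [Finset.sum_congr rfl fun k hk => by rw [hB k (Finset.ne_of_mem_erase hk)]]
      linarith
    · rw [if_neg h, hB k h]

lemma phaseless_eq_iff {m n : ℕ} (A : Matrix (Fin m) (Fin n) ℝ) (x y : Fin n → ℝ) :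
    phaseless A x = phaseless A y ↔ ∀ i, |A.mulVec x i| = |A.mulVec y i| := by
  simp only [funext_iff, phaseless]
  refine forall_congr' fun i => ?_
  rw [← NNReal.coe_inj]
  simp

/-- For a fixed vector `x` and an affine coordinate subspace of dimension less than `m`, almost
every `m`-row matrix distinguishes `x` from all vectors of the subspace other than `± x`. -/
lemma volume_phaseless_collision_eq_zero {m n : ℕ} (T : Finset (Fin n)) (hT : T.card < m)
    (s x : Fin n → ℝ) :
    volume {A : Fin m → Fin n → ℝ | ∃ y : Fin n → ℝ, (∀ l ∉ T, y l = s l) ∧ ¬ SignEquiv y x ∧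
      phaseless (Matrix.of A) y = phaseless (Matrix.of A) x} = 0 := by
  -- Equal absolute values give one sign per row. As `y ≠ ± x`, the vector `x - σ i • y` is nonzero
  -- and has a pivot coordinate `j i`; there are finitely many choices of `σ` and `j`.
  refine measure_mono_null (t := ⋃ (σ : Fin m → ℤˣ) (j : Fin m → Fin n),
    {A : Fin m → Fin n → ℝ | ∃ y : Fin n → ℝ, (∀ l ∉ T, y l = s l) ∧
      ∀ i, x (j i) - ((σ i : ℤ) : ℝ) * y (j i) ≠ 0 ∧
        ∑ k, A i k * (x k - ((σ i : ℤ) : ℝ) * y k) = 0}) ?_ ?_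
  · rintro A ⟨y, hy, hxy, hA⟩
    rw [phaseless_eq_iff] at hA
    have h1 : ∀ i, ∃ σ : ℤˣ, (Matrix.of A).mulVec x i =
        ((σ : ℤ) : ℝ) * (Matrix.of A).mulVec y i := by
      intro i
      rcases abs_eq_abs.1 (hA i) with h | h
      · exact ⟨1, by simp [h]⟩
      · exact ⟨-1, by simp [h]⟩
    choose σ hσ using h1
    have h2 : ∀ i, ∃ k, x k - ((σ i : ℤ) : ℝ) * y k ≠ 0 := by
      intro i
      by_contra! h
      apply hxy
      rcases Int.units_eq_one_or (σ i) with h' | h'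
      · left; funext k; have := h k; simp [h'] at this; linarith
      · right; funext k; have := h k; simp [h'] at this; simp; linarith
    choose j hj using h2
    simp only [Set.mem_iUnion]
    refine ⟨σ, j, y, hy, fun i => ⟨hj i, ?_⟩⟩
    have := hσ i
    simp only [Matrix.mulVec, dotProduct, Matrix.of_apply, Finset.mul_sum] at this
    simp only [mul_sub, Finset.sum_sub_distrib]
    rw [this, sub_eq_zero]
    exact Finset.sum_congr rfl fun k _ => by ring
  · simp only [measure_iUnion_null_iff]
    exact fun σ j => volume_rows_orthogonal_eq_zero T hT s x _ j

/-! ### Collisions with vectors mostly in a countable set -/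

open Classical in
/-- The number of coordinates of `x` that lie outside `S`. -/
noncomputable def numOutside (S : Set ℝ) {n : ℕ} (x : Fin n → ℝ) : ℕ :=
  (Finset.univ.filter fun i => x i ∉ S).card

/-- A pair `(x, A)` such that `A` does not separate `x` from some vector `y ≠ ± x` having fewer
than `m` coordinates outside `S`. -/
def Collides (S : Set ℝ) {m n : ℕ} (x : Fin n → ℝ) (A : Fin m → Fin n → ℝ) : Prop :=
  ∃ y : Fin n → ℝ, numOutside S y < m ∧ ¬ SignEquiv y x ∧
    phaseless (Matrix.of A) y = phaseless (Matrix.of A) x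

lemma numOutside_lt_iff {S : Set ℝ} (h0 : (0 : ℝ) ∈ S) {m n : ℕ} (x : Fin n → ℝ) :
    numOutside S x < m ↔ ∃ T : Finset (Fin n), T.card < m ∧
      ∃ s ∈ Set.univ.pi fun _ : Fin n => S, ∀ i ∉ T, x i = s i := by
  classical
  constructor
  · intro h
    refine ⟨_, h, fun i => if x i ∈ S then x i else 0, fun i _ => ?_, fun i hi => ?_⟩
    · dsimp only; split_ifs with hx
      exacts [hx, h0]
    · have : x i ∈ S := by simpa using hi
      simp [this]
  · rintro ⟨T, hT, s, hs, h⟩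
    refine lt_of_le_of_lt (Finset.card_le_card fun i hi => ?_) hT
    by_contra hiT
    have hx : x i ∉ S := by simpa using hi
    exact hx (h i hiT ▸ hs i trivial)

lemma collides_iff {S : Set ℝ} (h0 : (0 : ℝ) ∈ S) {m n : ℕ} (x : Fin n → ℝ)
    (A : Fin m → Fin n → ℝ) :
    Collides S x A ↔ ∃ T : Finset (Fin n), T.card < m ∧
      ∃ s ∈ Set.univ.pi fun _ : Fin n => S, ∃ y : Fin n → ℝ, (∀ i ∉ T, y i = s i) ∧
        ¬ SignEquiv y x ∧ phaseless (Matrix.of A) y = phaseless (Matrix.of A) x := by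
  simp only [Collides, numOutside_lt_iff h0]
  constructor
  · rintro ⟨y, ⟨T, hT, s, hs, h⟩, h'⟩
    exact ⟨T, hT, s, hs, y, h, h'⟩
  · rintro ⟨T, hT, s, hs, y, h, h'⟩
    exact ⟨y, ⟨T, hT, s, hs, h⟩, h'⟩

lemma volume_collides_eq_zero {S : Set ℝ} (hS : S.Countable) (h0 : (0 : ℝ) ∈ S) {m n : ℕ}
    (x : Fin n → ℝ) : volume {A : Fin m → Fin n → ℝ | Collides S x A} = 0 := by
  have hc : (Set.univ.pi fun _ : Fin n => S).Countable := Set.countable_univ_pi fun _ => hS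
  refine measure_mono_null (t := ⋃ (T : Finset (Fin n)) (_ : T.card < m),
    ⋃ s ∈ Set.univ.pi fun _ : Fin n => S, {A : Fin m → Fin n → ℝ | ∃ y : Fin n → ℝ,
      (∀ i ∉ T, y i = s i) ∧ ¬ SignEquiv y x ∧
        phaseless (Matrix.of A) y = phaseless (Matrix.of A) x}) (fun A hA => ?_) ?_
  · obtain ⟨T, hT, s, hs, h⟩ := (collides_iff h0 x A).1 hA
    simp only [Set.mem_iUnion]
    exact ⟨T, hT, s, hs, h⟩
  · refine measure_iUnion_null fun T => measure_iUnion_null fun hT =>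
      (measure_biUnion_null_iff hc).2 fun s _ => volume_phaseless_collision_eq_zero T hT s x

lemma IsSigmaCompact.measurableSet {α : Type*} [TopologicalSpace α] [T2Space α]
    [MeasurableSpace α] [OpensMeasurableSpace α] {s : Set α} (hs : IsSigmaCompact s) :
    MeasurableSet s := by
  obtain ⟨K, hK, rfl⟩ := hs
  exact MeasurableSet.iUnion fun i => (hK i).measurableSet

lemma continuous_phaseless {m n : ℕ} :
    Continuous fun p : (Fin m → Fin n → ℝ) × (Fin n → ℝ) => phaseless (Matrix.of p.1) p.2 := by
  refine continuous_pi fun i => (continuous_abs.subtype_mk abs_nonneg).comp ?_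
  simp only [Matrix.mulVec, dotProduct, Matrix.of_apply]
  fun_prop

lemma isClosed_signEquiv {n : ℕ} :
    IsClosed {p : (Fin n → ℝ) × (Fin n → ℝ) | SignEquiv p.1 p.2} :=
  (isClosed_eq continuous_fst continuous_snd).union (isClosed_eq continuous_fst continuous_snd.neg)

/-- Eliminating `y` is a projection, which need not preserve Borel sets. Here the open condition `¬
SignEquiv` is a countable union of closed sets, so the projected set is σ-compact, and so is its
image. -/
lemma measurableSet_collides {S : Set ℝ} (hS : S.Countable) (h0 : (0 : ℝ) ∈ S) (m n : ℕ) :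
    MeasurableSet {p : (Fin n → ℝ) × (Fin m → Fin n → ℝ) | Collides S p.1 p.2} := by
  have hc : (Set.univ.pi fun _ : Fin n => S).Countable := Set.countable_univ_pi fun _ => hS
  have hopen : IsOpen {p : ((Fin n → ℝ) × (Fin m → Fin n → ℝ)) × (Fin n → ℝ) | ¬ SignEquiv p.2 p.1.1} := by
    have : Continuous fun p : ((Fin n → ℝ) × (Fin m → Fin n → ℝ)) × (Fin n → ℝ) => (p.2, p.1.1) := by fun_prop
    exact (isClosed_signEquiv.preimage this).isOpen_compl
  obtain ⟨F, hF, -, hFU, -⟩ := hopen.exists_iUnion_isClosed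
  have heq : IsClosed {p : ((Fin n → ℝ) × (Fin m → Fin n → ℝ)) × (Fin n → ℝ) | phaseless (Matrix.of p.1.2) p.2 =
      phaseless (Matrix.of p.1.2) p.1.1} := by
    have h1 : Continuous fun p : ((Fin n → ℝ) × (Fin m → Fin n → ℝ)) × (Fin n → ℝ) => (p.1.2, p.2) := by fun_prop
    have h2 : Continuous fun p : ((Fin n → ℝ) × (Fin m → Fin n → ℝ)) × (Fin n → ℝ) => (p.1.2, p.1.1) := by fun_prop
    exact isClosed_eq (continuous_phaseless.comp h1) (continuous_phaseless.comp h2)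
  have haff : ∀ (T : Finset (Fin n)) (s : Fin n → ℝ), IsClosed {p : ((Fin n → ℝ) × (Fin m → Fin n → ℝ)) × (Fin n → ℝ) | ∀ i ∉ T, p.2 i = s i} := by
    intro T s
    simp only [Set.ofPred_forall]
    exact isClosed_iInter fun i => isClosed_iInter fun _ =>
      isClosed_eq (by fun_prop) continuous_const
  have key : {p : (Fin n → ℝ) × (Fin m → Fin n → ℝ) | Collides S p.1 p.2} =
      ⋃ (T : Finset (Fin n)) (_ : T.card < m), ⋃ s ∈ Set.univ.pi fun _ : Fin n => S, ⋃ k,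
        Prod.fst '' ({p : ((Fin n → ℝ) × (Fin m → Fin n → ℝ)) × (Fin n → ℝ) | ∀ i ∉ T, p.2 i = s i} ∩ F k ∩
          {p : ((Fin n → ℝ) × (Fin m → Fin n → ℝ)) × (Fin n → ℝ) | phaseless (Matrix.of p.1.2) p.2 = phaseless (Matrix.of p.1.2) p.1.1}) := by
    ext p
    simp only [Set.mem_ofPred_eq, collides_iff h0, Set.mem_iUnion, exists_prop]
    refine exists_congr fun T => and_congr_right fun _ => exists_congr fun s =>
      and_congr_right fun _ => ?_
    constructor
    · rintro ⟨y, h1, h2, h3⟩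
      have : (p, y) ∈ ⋃ k, F k := by rw [hFU]; exact h2
      obtain ⟨k, hk⟩ := Set.mem_iUnion.1 this
      exact ⟨k, (p, y), ⟨⟨h1, hk⟩, h3⟩, rfl⟩
    · rintro ⟨k, q, ⟨⟨h1, hk⟩, h3⟩, rfl⟩
      have : q ∈ ⋃ k, F k := Set.mem_iUnion.2 ⟨k, hk⟩
      rw [hFU] at this
      exact ⟨q.2, h1, this, h3⟩
  rw [key]
  refine MeasurableSet.iUnion fun T => MeasurableSet.iUnion fun _ =>
    MeasurableSet.biUnion hc fun s _ => MeasurableSet.iUnion fun k => ?_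
  refine IsSigmaCompact.measurableSet (IsSigmaCompact.image continuous_fst ?_)
  exact isSigmaCompact_univ.of_isClosed_subset (((haff T s).inter (hF k)).inter heq)
    (Set.subset_univ _)

lemma measurableSet_numOutside_lt {S : Set ℝ} (hS : S.Countable) (h0 : (0 : ℝ) ∈ S) (m n : ℕ) :
    MeasurableSet {x : Fin n → ℝ | numOutside S x < m} := by
  have hc : (Set.univ.pi fun _ : Fin n => S).Countable := Set.countable_univ_pi fun _ => hS
  have : {x : Fin n → ℝ | numOutside S x < m} = ⋃ (T : Finset (Fin n)) (_ : T.card < m),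
      ⋃ s ∈ Set.univ.pi fun _ : Fin n => S, ⋂ (i) (_ : i ∉ T), {x | x i = s i} := by
    ext x
    simp [numOutside_lt_iff h0]
  rw [this]
  exact MeasurableSet.iUnion fun T => MeasurableSet.iUnion fun _ =>
    MeasurableSet.biUnion hc fun s _ => MeasurableSet.iInter fun i => MeasurableSet.iInter fun _ =>
      measurableSet_eq_fun (measurable_pi_apply i) measurable_const

/-- Almost every matrix has almost no collisions. -/
lemma ae_ae_not_collides {S : Set ℝ} (hS : S.Countable) (h0 : (0 : ℝ) ∈ S) {m n : ℕ}
    (μ : Measure (Fin n → ℝ)) [SFinite μ] :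
    ∀ᵐ A : Fin m → Fin n → ℝ, ∀ᵐ x ∂μ, ¬ Collides S x A := by
  refine (Measure.ae_ae_comm (p := fun x A => ¬ Collides S x A)
    (measurableSet_collides hS h0 m n).compl).1 (Filter.Eventually.of_forall fun x => ?_)
  rw [ae_iff]
  simpa using volume_collides_eq_zero hS h0 x

/-! ### Borel decoders -/

lemma phaseless_neg {m n : ℕ} (A : Matrix (Fin m) (Fin n) ℝ) (x : Fin n → ℝ) :
    phaseless A (-x) = phaseless A x := by
  rw [phaseless_eq_iff]
  simp [Matrix.mulVec_neg]

/-- If a Borel set is closed under negation, and phaseless measurements separate its points up to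
sign, then there is a Borel decoder that recovers all of its points up to sign. -/
lemma exists_measurable_decoder {m n : ℕ} (A : Matrix (Fin m) (Fin n) ℝ) {G : Set (Fin n → ℝ)}
    (hG : MeasurableSet G) (hneg : ∀ x ∈ G, -x ∈ G)
    (hinj : ∀ x ∈ G, ∀ y ∈ G, phaseless A y = phaseless A x → SignEquiv y x) :
    ∃ g : (Fin m → ℝ≥0) → Fin n → ℝ, Measurable g ∧
      ∀ x ∈ G, SignEquiv (g (phaseless A x)) x := by
  -- The order pulled back from ℝ selects measurably one vector from each pair `± x`.
  let φ := embeddingReal (Fin n → ℝ)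
  have hφ := measurableEmbedding_embeddingReal (Fin n → ℝ)
  let H : Set (Fin n → ℝ) := G ∩ {x | φ (-x) ≤ φ x}
  have hH : MeasurableSet H :=
    hG.inter (measurableSet_le (hφ.measurable.comp measurable_neg) hφ.measurable)
  have hcont : Continuous (phaseless A) :=
    (continuous_phaseless (m := m) (n := n)).comp (Continuous.prodMk_right (X := Fin m → Fin n → ℝ) A)
  have hinjH : Set.InjOn (phaseless A) H := by
    intro x hx y hy hxy
    rcases hinj y hy.1 x hx.1 hxy with h | h
    · exact h
    · have h1 := hx.2
      have h2 := hy.2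
      rw [h] at h1
      simp only [Set.mem_ofPred_eq, neg_neg] at h1 h2
      rw [h, hφ.injective (le_antisymm h2 h1)]
  -- Lusin–Souslin: an injective continuous map on a Borel set has a Borel inverse.
  obtain ⟨g, hg, hgf⟩ := (hcont.continuousOn.measurableEmbedding hH hinjH).exists_measurable_extend
    (measurable_subtype_coe (p := (· ∈ H))) fun _ => ⟨0⟩
  refine ⟨g, hg, fun x hx => ?_⟩
  have hrec : ∀ y ∈ H, g (phaseless A y) = y := fun y hy => congrFun hgf ⟨y, hy⟩
  rcases le_total (φ (-x)) (φ x) with h | h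
  · exact Or.inl (hrec x ⟨hx, h⟩)
  · right
    rw [← phaseless_neg]
    exact hrec (-x) ⟨hneg x hx, by simpa using h⟩

lemma numOutside_neg {S : Set ℝ} (hS : ∀ a ∈ S, -a ∈ S) {n : ℕ} (x : Fin n → ℝ) :
    numOutside S (-x) = numOutside S x := by
  have : ∀ a, -a ∈ S ↔ a ∈ S := fun a => ⟨fun h => by simpa using hS _ h, hS a⟩
  unfold numOutside
  congr 1
  ext i
  simp [this]

lemma Collides.of_neg {S : Set ℝ} {m n : ℕ} {x : Fin n → ℝ} {A : Fin m → Fin n → ℝ}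
    (h : Collides S (-x) A) : Collides S x A := by
  obtain ⟨y, h1, h2, h3⟩ := h
  refine ⟨y, h1, fun h => h2 ?_, by rw [h3, phaseless_neg]⟩
  rcases h with h | h
  · right; simpa using h
  · left; exact h

/-- Every matrix has a Borel decoder recovering, up to sign, all vectors that have fewer than `m`
coordinates outside `S` and do not collide with another such vector. -/
lemma exists_decoder_of_not_collides {S : Set ℝ} (hS : S.Countable) (h0 : (0 : ℝ) ∈ S)
    (hneg : ∀ a ∈ S, -a ∈ S) {m n : ℕ} (A : Fin m → Fin n → ℝ) :
    ∃ g : (Fin m → ℝ≥0) → Fin n → ℝ, Measurable g ∧ ∀ x, numOutside S x < m → ¬ Collides S x A →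
      SignEquiv (g (phaseless (Matrix.of A) x)) x := by
  obtain ⟨g, hg, h⟩ := exists_measurable_decoder (Matrix.of A)
    (G := {x | numOutside S x < m} ∩ {x | Collides S x A}ᶜ)
    ((measurableSet_numOutside_lt hS h0 m n).inter
      (measurable_prodMk_right (measurableSet_collides hS h0 m n)).compl)
    (fun x hx => ⟨by simpa [numOutside_neg hneg] using hx.1, fun h => hx.2 h.of_neg⟩)
    (fun x hx y hy hxy => by
      by_contra hne
      exact hx.2 ⟨y, hy.1, hne, hxy⟩)
  exact ⟨g, hg, fun x h1 h2 => h x ⟨h1, h2⟩⟩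

/-! ### Law of large numbers and achievability -/

open Filter Topology

variable {Ω : Type*} [MeasurableSpace Ω]

lemma IsMixedSource.measure_preimage_compl {P : Measure Ω} {X : ℕ → Ω → ℝ} {lam : ℝ}
    {μd μc : Measure ℝ} (hX : IsMixedSource P X lam μd μc) {S : Set ℝ} (hS : S.Countable)
    (hd : μd Sᶜ = 0) (i : ℕ) : P.map (X i) Sᶜ = ENNReal.ofReal lam := by
  have := hX.prob_continuous
  have h1 : μc S = 0 := hX.absolutelyContinuous (hS.measure_zero _)
  have h2 : μc Sᶜ = 1 := (prob_compl_eq_one_iff hS.measurableSet).2 h1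
  simp [hX.law i, hd, h2]

lemma numOutside_sourceVector {Ω : Type*} (S : Set ℝ) (X : ℕ → Ω → ℝ) (n : ℕ) (ω : Ω) :
    (numOutside S (sourceVector X n ω) : ℝ) =
      ∑ i ∈ Finset.range n, Sᶜ.indicator (1 : ℝ → ℝ) (X i ω) := by
  rw [Finset.sum_range, numOutside, Finset.card_filter, Nat.cast_sum]
  refine Finset.sum_congr rfl fun i _ => ?_
  rw [sourceVector]
  by_cases h : X i ω ∈ S <;> simp [h]

/-- The fraction of the coordinates outside `S` converges to `lam` in probability. -/
lemma IsMixedSource.tendsto_numOutside {P : Measure Ω} [IsProbabilityMeasure P] {X : ℕ → Ω → ℝ}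
    {lam : ℝ} {μd μc : Measure ℝ} (hX : IsMixedSource P X lam μd μc) {S : Set ℝ}
    (hS : S.Countable) (hd : μd Sᶜ = 0) {δ : ℝ} (hδ : 0 < δ) :
    Tendsto (fun n : ℕ => P.real {ω | δ ≤ |numOutside S (sourceVector X n ω) / (n : ℝ) - lam|})
      atTop (𝓝 0) := by
  have hSm := hS.measurableSet.compl
  have hf : Measurable (Sᶜ.indicator (1 : ℝ → ℝ)) := measurable_one.indicator hSm
  have hm : ∀ i, Measurable fun ω => Sᶜ.indicator (1 : ℝ → ℝ) (X i ω) :=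
    fun i => hf.comp (hX.measurable i)
  have hexp : ∫ ω, Sᶜ.indicator (1 : ℝ → ℝ) (X 0 ω) ∂P = lam := by
    rw [← integral_map (hX.measurable 0).aemeasurable hf.aestronglyMeasurable,
      integral_indicator_one hSm, measureReal_def, hX.measure_preimage_compl hS hd,
      ENNReal.toReal_ofReal hX.lam_nonneg]
  have hlln := strong_law_ae_real (μ := P) (fun i ω => Sᶜ.indicator (1 : ℝ → ℝ) (X i ω))
    (Integrable.of_bound (hm 0).aestronglyMeasurable 1 (Eventually.of_forall fun ω => by
      by_cases h : X 0 ω ∈ S <;> simp [h]))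
    (fun i j hij => (hX.indep.indepFun hij).comp hf hf)
    (fun i => IdentDistrib.comp ⟨(hX.measurable i).aemeasurable, (hX.measurable 0).aemeasurable,
      by rw [hX.law, hX.law]⟩ hf)
  rw [hexp] at hlln
  have := tendstoInMeasure_of_tendsto_ae (μ := P) (fun n =>
    ((Finset.measurable_fun_sum (Finset.range n) fun i _ => hm i).div_const
      (n : ℝ)).aestronglyMeasurable) hlln
  rw [tendstoInMeasure_iff_measureReal_dist] at this
  simpa only [numOutside_sourceVector, Real.dist_eq] using this δ hδ

lemma measurable_sourceVector {X : ℕ → Ω → ℝ} (hX : ∀ i, Measurable (X i)) (n : ℕ) :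
    Measurable (sourceVector X n) :=
  measurable_pi_lambda _ fun i => hX i

/-- A discrete distribution is carried by a countable set containing zero and closed under
negation. -/
lemma IsMixedSource.exists_symmetric_carrier {P : Measure Ω} {X : ℕ → Ω → ℝ} {lam : ℝ}
    {μd μc : Measure ℝ} (hX : IsMixedSource P X lam μd μc) :
    ∃ S : Set ℝ, S.Countable ∧ μd Sᶜ = 0 ∧ 0 ∈ S ∧ ∀ a ∈ S, -a ∈ S := by
  obtain ⟨S, hS, hd⟩ := hX.discrete
  refine ⟨{0} ∪ (S ∪ -S), (Set.countable_singleton 0).union (hS.union ?_),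
    measure_mono_null ?_ hd, by simp, ?_⟩
  · rw [← Set.image_neg_eq_neg]; exact hS.image _
  · exact Set.compl_subset_compl.2 fun x hx => Or.inr (Or.inl hx)
  · rintro a (h | h | h)
    · left; simpa using h
    · right; right; simpa using h
    · right; left; exact h

theorem IsMixedSource.isAchievableForAlmostAll {P : Measure Ω} [IsProbabilityMeasure P]
    {X : ℕ → Ω → ℝ} {lam : ℝ} {μd μc : Measure ℝ} (hX : IsMixedSource P X lam μd μc)
    {ε R : ℝ} (hε : 0 < ε) (hR0 : 0 < R) (hR1 : R ≤ 1) (hR : lam < R) :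
    IsAchievableForAlmostAll P X ε R := by
  obtain ⟨S, hS, hd, h0, hneg⟩ := hX.exists_symmetric_carrier
  refine ⟨hR0, hR1, ?_⟩
  -- Half of the gap bounds the deviation; the other half absorbs the floor once `n ≥ ((R - lam) /
  -- 2)⁻¹`.
  have hδ : 0 < (R - lam) / 2 := by linarith
  have hev := ((hX.tendsto_numOutside hS hd hδ).eventually_le_const hε).and
    ((tendsto_natCast_atTop_atTop (R := ℝ)).eventually_ge_atTop ((R - lam) / 2)⁻¹)
  obtain ⟨N, hN⟩ := eventually_atTop.1 hev
  refine ⟨N, fun n hn => ?_⟩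
  obtain ⟨h1, h2⟩ := hN n hn
  have hn0 : (0 : ℝ) < n := (inv_pos.2 hδ).trans_le h2
  have hx := measurable_sourceVector hX.measurable n
  filter_upwards [ae_ae_not_collides hS h0 (m := ⌊R * n⌋₊) (P.map (sourceVector X n))] with A hA
  obtain ⟨g, hg, hgA⟩ := exists_decoder_of_not_collides hS h0 hneg A
  refine ⟨⟨Matrix.of A, g, hg⟩, rfl, le_trans ?_ h1⟩
  have hA' : ∀ᵐ ω ∂P, ¬ Collides S (sourceVector X n ω) A := ae_of_ae_map hx.aemeasurable hA
  refine ENNReal.toReal_mono (measure_ne_top _ _) (measure_mono_ae ?_)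
  filter_upwards [hA'] with ω hω herr
  have h3 : ⌊R * n⌋₊ ≤ numOutside S (sourceVector X n ω) := by
    by_contra! hlt
    exact herr (hgA _ hlt hω)
  have h4 : R * n - 1 < numOutside S (sourceVector X n ω) :=
    (Nat.sub_one_lt_floor _).trans_le (by exact_mod_cast h3)
  change (R - lam) / 2 ≤ |_|
  refine le_trans ?_ (le_abs_self _)
  rw [le_sub_iff_add_le, le_div_iff₀ hn0]
  have h5 : 1 ≤ (R - lam) / 2 * n := by
    rw [← mul_inv_cancel₀ hδ.ne']
    gcongr
  nlinarith

lemma IsAchievableForAlmostAll.isAchievable {P : Measure Ω} {X : ℕ → Ω → ℝ} {ε R : ℝ}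
    (h : IsAchievableForAlmostAll P X ε R) : IsAchievable P X ε R := by
  obtain ⟨hR0, hR1, N, hN⟩ := h
  have : ∀ n : ℕ, ∃ c : Code n ⌊R * n⌋₊, N ≤ n → errorProb P X c ≤ ε := by
    intro n
    by_cases hn : N ≤ n
    · obtain ⟨A, c, -, hc⟩ := (hN n hn).exists
      exact ⟨c, fun _ => hc⟩
    · exact ⟨⟨0, fun _ => 0, measurable_const⟩, fun h => absurd h hn⟩
  choose c hc using this
  exact ⟨hR0, hR1, N, c, hc⟩

/-! ### Converse -/

lemma absolutelyContinuous_pi {n : ℕ} {α : Type*} [MeasurableSpace α] {μ ν : Fin n → Measure α}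
    [∀ i, SigmaFinite (μ i)] [∀ i, SigmaFinite (ν i)] (h : ∀ i, μ i ≪ ν i) :
    Measure.pi μ ≪ Measure.pi ν := by
  induction n with
  | zero => rw [Subsingleton.elim μ ν]
  | succ n ih =>
    have hμ := (measurePreserving_piFinSuccAbove μ 0).symm
    have hν := (measurePreserving_piFinSuccAbove ν 0).symm
    rw [← hμ.map_eq, ← hν.map_eq]
    exact ((h 0).prod (ih fun i => h _)).map (MeasurableEquiv.measurable _)

/-- A Borel set meeting every translate of the line `ℝ w` in a null set is null for every
σ-finite measure invariant under the translations along `w`. -/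
lemma measure_eq_zero_of_line_null {n : ℕ} (μ : Measure (Fin n → ℝ)) [SFinite μ]
    {D : Set (Fin n → ℝ)} (hD : MeasurableSet D) (w : Fin n → ℝ)
    (hinv : ∀ r : ℝ, MeasurePreserving (fun x => x + r • w) μ μ)
    (hline : ∀ x, volume {r : ℝ | x + r • w ∈ D} = 0) : μ D = 0 := by
  have hmeas : MeasurableSet {p : (Fin n → ℝ) × ℝ | p.1 + p.2 • w ∉ D} := by
    have : Measurable fun p : (Fin n → ℝ) × ℝ => p.1 + p.2 • w := by fun_prop
    exact this hD.compl
  have h := (Measure.ae_ae_comm (μ := μ) (ν := (volume : Measure ℝ))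
    (p := fun x r => x + r • w ∉ D) hmeas).1
    (Eventually.of_forall fun x => by rw [ae_iff]; simpa using hline x)
  -- Almost every translate of `D` is null; by invariance a single one suffices.
  obtain ⟨r, hr⟩ := h.exists
  rw [ae_iff] at hr
  rw [← (hinv r).measure_preimage hD.nullMeasurableSet]
  simp only [not_not] at hr
  exact hr

lemma exists_mulVec_eq_zero_of_card_lt {m n : ℕ} (A : Matrix (Fin m) (Fin n) ℝ)
    (T : Finset (Fin n)) (hT : m < T.card) :
    ∃ w : Fin n → ℝ, w ≠ 0 ∧ (∀ i ∉ T, w i = 0) ∧ A.mulVec w = 0 := by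
  let E := Function.ExtendByZero.linearMap ℝ (Subtype.val : T → Fin n)
  have hker : LinearMap.ker (A.mulVecLin ∘ₗ E) ≠ ⊥ :=
    LinearMap.ker_ne_bot_of_finrank_lt (by simpa using hT)
  obtain ⟨v, hv, hv0⟩ := (Submodule.ne_bot_iff _).1 hker
  refine ⟨E v, fun h => hv0 ?_, fun i hi => ?_, hv⟩
  · funext l
    have := congrFun h l
    simpa [E, Function.ExtendByZero.linearMap_apply, Subtype.val_injective.extend_apply] using this
  · have : ¬ ∃ l : T, l.1 = i := by rintro ⟨l, rfl⟩; exact hi l.2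
    simp [E, Function.ExtendByZero.linearMap_apply, Function.extend_apply' _ _ _ this]

lemma volume_line_signEquiv_eq_zero {n : ℕ} {w : Fin n → ℝ} (hw : w ≠ 0) (x a : Fin n → ℝ) :
    volume {r : ℝ | SignEquiv a (x + r • w)} = 0 := by
  have hsub : ∀ b : Fin n → ℝ, {r : ℝ | b = x + r • w}.Subsingleton := by
    intro b r hr s hs
    have : r • w = s • w := add_left_cancel (hr.symm.trans hs)
    exact smul_left_injective ℝ hw this
  have : {r : ℝ | SignEquiv a (x + r • w)} ⊆ {r : ℝ | a = x + r • w} ∪ {r : ℝ | -a = x + r • w} :=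
    fun r hr => hr.imp id fun h => by simp only [Set.mem_ofPred_eq]; rw [h, neg_neg]
  exact measure_mono_null this (measure_union_null ((hsub a).measure_zero _)
    ((hsub (-a)).measure_zero _))

/-- Almost no vector with more than `m` coordinates from the continuous part is recovered. -/
lemma pi_recovered_eq_zero {m n : ℕ} (c : Code n m) (π : Measure ℝ) [IsProbabilityMeasure π]
    {S : Set ℝ} (hac : π.restrict Sᶜ ≪ volume) (T : Finset (Fin n)) (hT : m < T.card) :
    Measure.pi (fun _ : Fin n => π) ({x | SignEquiv (c.decoder (phaseless c.mat x)) x} ∩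
      {x | ∀ i ∈ T, x i ∉ S}) = 0 := by
  classical
  set D := {x : Fin n → ℝ | SignEquiv (c.decoder (phaseless c.mat x)) x} with hDdef
  have hcont : Continuous (phaseless c.mat) := (continuous_phaseless (m := m) (n := n)).comp
    (Continuous.prodMk_right (X := Fin m → Fin n → ℝ) c.mat)
  have hD : MeasurableSet D :=
    ((c.measurable_decoder.comp hcont.measurable).prodMk measurable_id)
      isClosed_signEquiv.measurableSet
  have hbox : {x : Fin n → ℝ | ∀ i ∈ T, x i ∉ S} =
      Set.univ.pi fun i => if i ∈ T then Sᶜ else Set.univ := by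
    ext x
    simp only [Set.mem_ofPred_eq, Set.mem_univ_pi]
    refine forall_congr' fun i => ?_
    by_cases h : i ∈ T <;> simp [h]
  rw [hbox, ← Measure.restrict_apply hD, Measure.restrict_pi_pi]
  -- Lebesgue measure on the coordinates in `T` makes the product invariant along `w`, which
  -- vanishes off `T`.
  let ν : Fin n → Measure ℝ := fun i => if i ∈ T then volume else π
  have hνσ : ∀ i, SigmaFinite (ν i) := fun i => by
    by_cases h : i ∈ T <;> simp only [ν, h, if_true, if_false] <;> infer_instance
  refine absolutelyContinuous_pi (ν := ν) (fun i => ?_) ?_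
  · by_cases h : i ∈ T
    · simpa [ν, h] using hac
    · simp only [ν, h, if_false, Measure.restrict_univ]; exact Measure.AbsolutelyContinuous.rfl
  obtain ⟨w, hw, hwT, hAw⟩ := exists_mulVec_eq_zero_of_card_lt c.mat T hT
  refine measure_eq_zero_of_line_null _ hD w (fun r => ?_) fun x => ?_
  · refine measurePreserving_pi ν ν (f := fun i t => t + r * w i) fun i => ?_
    by_cases h : i ∈ T
    · simp only [ν, h, if_true]
      exact measurePreserving_add_right volume _
    · simp only [hwT i h, mul_zero, add_zero]
      exact MeasurePreserving.id _
  · have : ∀ r : ℝ, phaseless c.mat (x + r • w) = phaseless c.mat x := fun r => by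
      rw [phaseless_eq_iff]
      simp [Matrix.mulVec_add, Matrix.mulVec_smul, hAw]
    simp only [hDdef, Set.mem_ofPred_eq, this]
    exact volume_line_signEquiv_eq_zero hw x _

theorem IsMixedSource.le_of_isAchievable {P : Measure Ω} [IsProbabilityMeasure P]
    {X : ℕ → Ω → ℝ} {lam : ℝ} {μd μc : Measure ℝ} (hX : IsMixedSource P X lam μd μc)
    {ε R : ℝ} (hε : ε < 1) (h : IsAchievable P X ε R) : lam ≤ R := by
  obtain ⟨S, hS, hd, -, -⟩ := hX.exists_symmetric_carrier
  obtain ⟨hR0, hR1, N, c, hc⟩ := h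
  by_contra! hlt
  have hev := ((hX.tendsto_numOutside hS hd (sub_pos.2 hlt)).eventually_lt_const
    (sub_pos.2 hε)).and ((eventually_ge_atTop N).and (eventually_gt_atTop 0))
  obtain ⟨n, h1, h2, h3⟩ := hev.exists
  have hn0 : (0 : ℝ) < n := by exact_mod_cast h3
  have hx := measurable_sourceVector hX.measurable n
  have hlaw : P.map (sourceVector X n) = Measure.pi fun _ : Fin n => P.map (X 0) := by
    have hi := hX.indep.precomp (g := fun i : Fin n => (i : ℕ)) Fin.val_injective
    have := (iIndepFun_iff_map_fun_eq_pi_map fun i : Fin n =>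
      (hX.measurable i).aemeasurable).1 hi
    simp only [hX.law] at this ⊢
    exact this
  have hprob : IsProbabilityMeasure (P.map (X 0)) :=
    Measure.isProbabilityMeasure_map (hX.measurable 0).aemeasurable
  have hac : (P.map (X 0)).restrict Sᶜ ≪ volume := by
    rw [hX.law, Measure.restrict_add, Measure.restrict_smul, Measure.restrict_smul,
      Measure.restrict_eq_zero.2 hd, smul_zero, zero_add]
    exact (Measure.absolutelyContinuous_of_le Measure.restrict_le_self |>.trans
      hX.absolutelyContinuous).smul_left _
  set m := ⌊R * n⌋₊
  have hnull : ∀ᵐ ω ∂P, m < numOutside S (sourceVector X n ω) →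
      ¬ SignEquiv ((c n).decoder (phaseless (c n).mat (sourceVector X n ω)))
        (sourceVector X n ω) := by
    refine ae_of_ae_map (p := fun x => m < numOutside S x →
      ¬ SignEquiv ((c n).decoder (phaseless (c n).mat x)) x) hx.aemeasurable ?_
    rw [hlaw]
    have : ∀ T : Finset (Fin n), m < T.card → ∀ᵐ x ∂Measure.pi fun _ : Fin n => P.map (X 0),
        ¬ (SignEquiv ((c n).decoder (phaseless (c n).mat x)) x ∧ ∀ i ∈ T, x i ∉ S) := by
      intro T hT
      rw [ae_iff]
      simp only [not_not]
      exact pi_recovered_eq_zero (c n) (P.map (X 0)) hac T hT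
    have := ae_all_iff.2 fun T => ae_all_iff.2 (this T)
    filter_upwards [this] with x hxT hm hrec
    exact hxT _ hm ⟨hrec, fun i hi => by simpa using hi⟩
  -- Almost surely either decoding fails or at most `m ≤ R n` coordinates lie outside `S`, a
  -- deviation of at least `lam - R`. The latter has probability below `1 - ε`.
  have hle : (1 : ℝ) ≤ errorProb P X (c n) +
      P.real {ω | lam - R ≤ |numOutside S (sourceVector X n ω) / (n : ℝ) - lam|} := by
    refine le_trans ?_ (measureReal_union_le _ _)
    rw [← probReal_univ (μ := P)]
    refine ENNReal.toReal_mono (measure_ne_top _ _) (measure_mono_ae ?_)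
    filter_upwards [hnull] with ω hω _
    by_cases hm : m < numOutside S (sourceVector X n ω)
    · exact Or.inl (hω hm)
    · right
      have h4 : (numOutside S (sourceVector X n ω) : ℝ) ≤ R * n :=
        le_trans (by exact_mod_cast not_lt.1 hm) (Nat.floor_le (by positivity))
      change lam - R ≤ |_|
      rw [abs_sub_comm]
      refine le_trans ?_ (le_abs_self _)
      have := (div_le_iff₀ hn0).2 h4
      linarith
  have := hc n h2
  linarith

end PhaselessCompression

theorem mainTheorem3 {Ω : Type*} [MeasurableSpace Ω] (P : Measure Ω) [IsProbabilityMeasure P]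
    (X : ℕ → Ω → ℝ) (lam : ℝ) (μd μc : Measure ℝ)
    (hX : PhaselessCompression.IsMixedSource P X lam μd μc)
    (ε : ℝ) (hε0 : 0 < ε) (hε1 : ε < 1) (R : ℝ) (hR0 : 0 < R) (hR1 : R ≤ 1) :
    (lam < R →
      PhaselessCompression.IsAchievableForAlmostAll P X ε R ∧
        PhaselessCompression.IsAchievable P X ε R) ∧
    (PhaselessCompression.IsAchievable P X ε R → lam ≤ R) := by
  refine ⟨fun hR => ?_, hX.le_of_isAchievable hε1⟩
  have h := hX.isAchievableForAlmostAll hε0 hR0 hR1 hR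
  exact ⟨h, h.isAchievable⟩
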